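/- Let $G=(V,E)$ be a finite simple graph with $n$ vertices and maximum degree $\Delta$, and let every vertex $v$ have a palette $\operatorname{Pal}(v)$ of exactly $\Delta+1$ colors. Let $\epsilon\in[0,1]$. An edge $uv$ is a friend edge if $|N(u)\cap N(v)|\ge(1-\epsilon)\Delta$; then $u$ and $v$ are friends. A vertex is dense if it has at least $(1-\epsilon)\Delta$ friends, and sparse otherwise. In the initial coloring step, every vertex $v$ independently chooses a tentative color $A(v)$: with probability $99/100$ it chooses none, and with probability $1/100$ it chooses a uniformly random color of $\operatorname{Pal}(v)$. If $v$ chose a color and no neighbor $w$ of $v$ has $A(w)=A(v)$, then $v$ receives the permanent color $\chi(v)=A(v)$; otherwise $v$ stays uncolored. For every vertex $v$ let $$Q_0(v)=\bigl|\operatorname{Pal}(v)\setminus\{\chi(w): w\in N(v),\ w \text{ colored}\}\bigr|,\qquad d_0(v)=|\{w\in N(v): w\text{ uncolored}\}|,\qquad S_0(v)=Q_0(v)-d_0(v)$$ be the residual palette size, the uncolored degree and the color surplus after this step. **Theorem.** There is a universal constant $c>0$ such that for every $K'>0$ there is a constant $K_0>0$, depending only on $K'$, with the following property for all $K\ge K_0$.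 For all $G$, palettes and $\epsilon$ as above with $\epsilon^4\Delta\ge K\ln n$, with probability at least $1-n^{-K'}$ the following two properties hold simultaneously: 1. every vertex $v$ has $Q_0(v)\ge\Delta/2$; 2. every sparse vertex $v$ has $S_0(v)\ge c\,\epsilon^2\Delta$. -/

import Mathlib

open MeasureTheory
open scoped ENNReal

noncomputable section

namespace InitialColoring

universe u w

variable {V : Type u} [Fintype V] [DecidableEq V]

/-! ### Sparse and dense vertices -/

/-- The edge `uv` is a friend edge: `u` and `v` are adjacent and share at least `(1 - ε) Δ`
neighbors, where `Δ` is the maximum degree of `G`. -/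
def IsFriend (G : SimpleGraph V) [DecidableRel G.Adj] (ε : ℝ) (u v : V) : Prop :=
  G.Adj u v ∧
    (1 - ε) * (G.maxDegree : ℝ) ≤ ((G.neighborFinset u ∩ G.neighborFinset v).card : ℝ)

open Classical in
/-- The set of friends of `v`. -/
def friends (G : SimpleGraph V) [DecidableRel G.Adj] (ε : ℝ) (v : V) : Finset V :=
  Finset.univ.filter fun u => IsFriend G ε v u

/-- A vertex is dense if it has at least `(1 - ε) Δ` friends. -/
def IsDense (G : SimpleGraph V) [DecidableRel G.Adj] (ε : ℝ) (v : V) : Prop :=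
  (1 - ε) * (G.maxDegree : ℝ) ≤ ((friends G ε v).card : ℝ)

/-- A vertex is sparse if it is not dense. -/
def IsSparse (G : SimpleGraph V) [DecidableRel G.Adj] (ε : ℝ) (v : V) : Prop :=
  ¬ IsDense G ε v

/-! ### Palettes and the random tentative colors -/

/-- An assignment of palettes of exactly `Δ + 1` colors (from an arbitrary set `C` of colors) to
the vertices of `G`. -/
structure Palettes (G : SimpleGraph V) [DecidableRel G.Adj] (C : Type w) where
  /-- The palette of a vertex. -/
  pal : V → Finset C
  /-- Every palette has `Δ + 1` colors. -/
  card_pal : ∀ v, (pal v).card = G.maxDegree + 1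

variable {G : SimpleGraph V} [DecidableRel G.Adj] {C : Type w}

/-- The values that the tentative color of `v` may take: `none` is the blank color, and `some c`
is the color `c` of the palette of `v`. -/
def Choice (L : Palettes G C) (v : V) : Type w := Option (L.pal v)

instance (L : Palettes G C) (v : V) : Fintype (Choice L v) :=
  inferInstanceAs (Fintype (Option (L.pal v)))

instance (L : Palettes G C) (v : V) : MeasurableSpace (Choice L v) := ⊤

instance (L : Palettes G C) (v : V) : DiscreteMeasurableSpace (Choice L v) :=
  ⟨fun _ => trivial⟩

/-- The law of the tentative color of `v`: the blank color has probability `99/100`, and each of the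
`Δ + 1` colors of the palette of `v` has probability `(1/100) / (Δ + 1)`. -/
def choiceLaw (L : Palettes G C) (v : V) : PMF (Choice L v) :=
  PMF.ofFintype
    (fun a : Option (L.pal v) =>
      match a with
      | none => 99 / 100
      | some _ => (1 / 100) / ((G.maxDegree + 1 : ℕ) : ℝ≥0∞))
    (by
      change ∑ a : Option (L.pal v), _ = _
      rw [Fintype.sum_option]
      simp only [Finset.sum_const, Finset.card_univ, Fintype.card_coe, L.card_pal, nsmul_eq_mul]
      rw [ENNReal.mul_div_cancel (by simp) (by simp), ENNReal.div_add_div_same]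
      rw [show (99 : ℝ≥0∞) + 1 = 100 by norm_num]
      exact ENNReal.div_self (by norm_num) (by norm_num))

/-- The joint law of the tentative colors, which are chosen independently. -/
def tentativeLaw (L : Palettes G C) : Measure (∀ v, Choice L v) :=
  Measure.pi fun v => (choiceLaw L v).toMeasure

/-- The tentative color `A(v)`, as a color in `C` or `none` for the blank color. -/
def tentative (L : Palettes G C) (ω : ∀ v, Choice L v) (v : V) : Option C :=
  Option.map Subtype.val (show Option (L.pal v) from ω v)

/-! ### The outcome of the initial coloring step -/

variable [DecidableEq C]

/-- The permanent color `χ(v)` after the initial coloring step: the tentative color is discarded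
if some neighbor has the same tentative color. -/
def permanent (L : Palettes G C) (ω : ∀ v, Choice L v) (v : V) : Option C :=
  if ∃ x, G.Adj v x ∧ tentative L ω x = tentative L ω v then none else tentative L ω v

/-- The residual palette of `v`: the permanent colors of its neighbors are removed. -/
def residualPalette (L : Palettes G C) (ω : ∀ v, Choice L v) (v : V) : Finset C :=
  (L.pal v).filter fun c => ∀ x, G.Adj v x → permanent L ω x ≠ some c

/-- The residual palette size `Q₀(v)`. -/
def paletteSize (L : Palettes G C) (ω : ∀ v, Choice L v) (v : V) : ℕ :=
  (residualPalette L ω v).card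

/-- The uncolored degree `d₀(v)`: the number of neighbors of `v` without permanent color. -/
def uncoloredDegree (L : Palettes G C) (ω : ∀ v, Choice L v) (v : V) : ℕ :=
  ((G.neighborFinset v).filter fun x => permanent L ω x = none).card

/-- The color surplus `S₀(v) = Q₀(v) - d₀(v)`, an integer. -/
def surplus (L : Palettes G C) (ω : ∀ v, Choice L v) (v : V) : ℤ :=
  (paletteSize L ω v : ℤ) - (uncoloredDegree L ω v : ℤ)

end InitialColoring

end

/-! Let `D` be the maximum degree. A color of `Pal(v)` won by `j ≥ 1` neighbors costs one palette
entry but colors `j` neighbors, and a color outside `Pal(v)` costs nothing. Hence the surplus is at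
least `D + 1 - deg v` plus the number `excess` of colors that win at least two neighbors, or at
least one if outside `Pal(v)` (`le_surplus`).

If `deg v < (1 - ε²/4) D`, the missing neighbors alone suffice. Otherwise a sparse `v` has at least
`εD/2` neighbors that are not friends, each nonadjacent to at least `εD/2` other neighbors
(`le_card_nonadjacentPairs`). Such a pair either shares about `D` colors with `Pal(v)`, and may win
one of them together, or has many colors outside `Pal(v)`. Either way the expected excess has order
`ε²D` (`card_nonadjacentPairs_le_integral_excess`).

The excess depends on up to about `D²` choices, too many for plain bounded differences with constant
oscillation. But a vertex outside `N(v)` acts only by vetoing a color chosen by a common neighbor;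
averaged over the choices in `N(v)` its influence is `O(1/D)` per common neighbor. Two-stage
exposure therefore gives variance proxy `O(D)` (`integral_exp_excess_le`), hence failure probability
`exp(-Ω(ε⁴D))`. The palette bound holds because only about `D/100` neighbors choose a color at all.
A union bound over the vertices concludes. -/

set_option linter.unusedSectionVars false

noncomputable section

/-! ### Bounded differences for functions on finite product spaces -/

namespace ProductConcentration

variable {ι : Type*} [Fintype ι] [DecidableEq ι] {α : ι → Type*} [∀ i, MeasurableSpace (α i)]

/-- Resampling the coordinates in `s` preserves a product probability measure. -/
theorem measurePreserving_piecewise (μ : ∀ i, Measure (α i)) [∀ i, IsProbabilityMeasure (μ i)]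
    (s : Finset ι) :
    MeasurePreserving (fun p : (∀ i, α i) × (∀ i, α i) => s.piecewise p.1 p.2)
      ((Measure.pi μ).prod (Measure.pi μ)) (Measure.pi μ) := by
  have hm : Measurable (fun p : (∀ i, α i) × (∀ i, α i) => s.piecewise p.1 p.2) := by
    refine measurable_pi_lambda _ fun i => ?_
    by_cases hi : i ∈ s
    · simpa [Finset.piecewise, hi, Function.comp_def] using (measurable_pi_apply i).comp measurable_fst
    · simpa [Finset.piecewise, hi, Function.comp_def] using (measurable_pi_apply i).comp measurable_snd
  refine ⟨hm, (Measure.pi_eq fun t ht => ?_).symm⟩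
  rw [Measure.map_apply hm (MeasurableSet.univ_pi ht)]
  have hpre : (fun p : (∀ i, α i) × (∀ i, α i) => s.piecewise p.1 p.2) ⁻¹' (Set.univ.pi t) =
      (Set.univ.pi fun i => if i ∈ s then t i else Set.univ) ×ˢ
        (Set.univ.pi fun i => if i ∈ s then Set.univ else t i) := by
    ext p
    simp only [Set.mem_preimage, Set.mem_pi, Set.mem_univ, true_implies, Set.mem_prod,
      Finset.piecewise, ← forall_and]
    refine forall_congr' fun i => ?_
    by_cases hi : i ∈ s <;> simp [hi]
  rw [hpre, Measure.prod_prod, Measure.pi_pi, Measure.pi_pi, ← Finset.prod_mul_distrib]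
  refine Finset.prod_congr rfl fun i _ => ?_
  by_cases hi : i ∈ s <;> simp [hi]

variable [∀ i, Finite (α i)] [∀ i, MeasurableSingletonClass (α i)]

theorem integral_integral_piecewise (μ : ∀ i, Measure (α i)) [∀ i, IsProbabilityMeasure (μ i)]
    (s : Finset ι) (f : (∀ i, α i) → ℝ) :
    ∫ ω, ∫ η, f (s.piecewise η ω) ∂Measure.pi μ ∂Measure.pi μ = ∫ ω, f ω ∂Measure.pi μ := by
  have hmp := measurePreserving_piecewise μ s
  have h := integral_map (μ := (Measure.pi μ).prod (Measure.pi μ)) hmp.measurable.aemeasurable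
    (measurable_of_finite f).aestronglyMeasurable
  rw [hmp.map_eq, integral_prod_symm _ Integrable.of_finite] at h
  exact h.symm

/-- Hoeffding's bound for the exponential moment of a function of small oscillation. -/
theorem integral_exp_le_of_oscillation {Ω : Type*} [Finite Ω] [MeasurableSpace Ω]
    [MeasurableSingletonClass Ω] (μ : Measure Ω) [IsProbabilityMeasure μ] (X : Ω → ℝ) (c l : ℝ)
    (hX : ∀ x y, |X x - X y| ≤ c) :
    ∫ x, Real.exp (l * X x) ∂μ ≤ Real.exp (l * ∫ x, X x ∂μ + l ^ 2 * c ^ 2 / 8) := by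
  have hne : Nonempty Ω := nonempty_of_isProbabilityMeasure μ
  obtain ⟨x₀, hx₀⟩ := Finite.exists_min X
  have hc : ∀ x, X x ∈ Set.Icc (X x₀) (X x₀ + c) := fun x =>
    ⟨hx₀ x, by linarith [(abs_le.1 (hX x x₀)).2]⟩
  have hc0 : 0 ≤ c := (abs_nonneg _).trans (hX x₀ x₀)
  have h := (ProbabilityTheory.hasSubgaussianMGF_of_mem_Icc (μ := μ)
    (measurable_of_finite X).aemeasurable (Filter.Eventually.of_forall hc)).mgf_le l
  rw [ProbabilityTheory.mgf] at h
  have h1 : ∀ x, Real.exp (l * X x) =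
      Real.exp (l * ∫ x, X x ∂μ) * Real.exp (l * (X x - ∫ x, X x ∂μ)) := fun x => by
    rw [← Real.exp_add]; congr 1; ring
  simp_rw [h1]
  rw [integral_const_mul, Real.exp_add]
  refine mul_le_mul_of_nonneg_left (h.trans (le_of_eq ?_)) (Real.exp_nonneg _)
  congr 1
  have : ‖X x₀ + c - X x₀‖ = c := by rw [add_sub_cancel_left, Real.norm_of_nonneg hc0]
  push_cast
  rw [this]
  ring

/-- A bounded differences estimate for the exponential moment, for the average over the
coordinates in `s`. -/
theorem integral_exp_le_integral_exp_average (μ : ∀ i, Measure (α i))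
    [∀ i, IsProbabilityMeasure (μ i)] (f : (∀ i, α i) → ℝ) (c : ι → ℝ) (l : ℝ)
    (hf : ∀ i ω η, |f (({i} : Finset ι).piecewise η ω) - f ω| ≤ c i) (s : Finset ι) :
    ∫ ω, Real.exp (l * f ω) ∂Measure.pi μ ≤ Real.exp (l ^ 2 * (∑ i ∈ s, c i ^ 2) / 8) *
      ∫ ω, Real.exp (l * ∫ η, f (s.piecewise η ω) ∂Measure.pi μ) ∂Measure.pi μ := by
  induction s using Finset.induction_on with
  | empty => simp
  | insert i s hi ih =>
    refine ih.trans ?_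
    rw [Finset.sum_insert hi, add_comm (c i ^ 2), mul_add, add_div, Real.exp_add, mul_assoc]
    refine mul_le_mul_of_nonneg_left ?_ (Real.exp_nonneg _)
    set g : (∀ i, α i) → ℝ := fun ω => ∫ η, f (s.piecewise η ω) ∂Measure.pi μ with hg
    -- Tower property: averaging over `insert i s` is averaging over `s`, then over coordinate `i`.
    have htower : ∀ ω, ∫ η, f ((insert i s).piecewise η ω) ∂Measure.pi μ =
        ∫ ζ, g (({i} : Finset ι).piecewise ζ ω) ∂Measure.pi μ := fun ω => by
      rw [← integral_integral_piecewise μ {i}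
        (fun η => f ((insert i s).piecewise η ω))]
      rw [integral_integral_swap Integrable.of_finite]
      refine integral_congr_ae (Filter.Eventually.of_forall fun ζ => ?_)
      simp only [hg]
      refine integral_congr_ae (Filter.Eventually.of_forall fun η => ?_)
      simp only
      congr 1
      funext j
      by_cases hj : j = i
      · subst hj; simp [Finset.piecewise, hi]
      · by_cases hjs : j ∈ s <;> simp [Finset.piecewise, hj, hjs]
    rw [← integral_integral_piecewise μ {i} (fun ω => Real.exp (l * g ω)), ← integral_const_mul]
    refine integral_mono Integrable.of_finite Integrable.of_finite fun ω => ?_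
    simp only
    rw [htower ω, ← Real.exp_add]
    -- With `ω` fixed, `g` is a function of the resampled coordinate `i` only, and averaging over
    -- `s` does not increase its oscillation; Hoeffding applies.
    have h := integral_exp_le_of_oscillation (Measure.pi μ)
      (fun ζ => g (({i} : Finset ι).piecewise ζ ω)) (c i) l fun ζ ζ' => ?_
    · exact h.trans (le_of_eq (by congr 1; ring))
    · simp only [hg]
      rw [← integral_sub Integrable.of_finite Integrable.of_finite]
      rw [← Real.norm_eq_abs, ← mul_one (c i), ← probReal_univ (μ := Measure.pi μ)]
      refine norm_integral_le_of_norm_le_const (μ := Measure.pi μ)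
        (Filter.Eventually.of_forall fun η => ?_)
      have h2 := hf i (s.piecewise η (({i} : Finset ι).piecewise ζ' ω)) ζ
      rw [Real.norm_eq_abs]
      have h3 : ({i} : Finset ι).piecewise ζ
          (s.piecewise η (({i} : Finset ι).piecewise ζ' ω)) =
          s.piecewise η (({i} : Finset ι).piecewise ζ ω) := by
        funext j
        by_cases hj : j = i
        · subst hj; simp [Finset.piecewise, hi]
        · by_cases hjs : j ∈ s <;> simp [Finset.piecewise, hj, hjs]
      rwa [h3] at h2

/-- McDiarmid's exponential moment bound. -/
theorem integral_exp_le (μ : ∀ i, Measure (α i))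
    [∀ i, IsProbabilityMeasure (μ i)] (f : (∀ i, α i) → ℝ) (c : ι → ℝ) (l : ℝ)
    (hf : ∀ i ω η, |f (({i} : Finset ι).piecewise η ω) - f ω| ≤ c i) :
    ∫ ω, Real.exp (l * f ω) ∂Measure.pi μ ≤
      Real.exp (l * (∫ ω, f ω ∂Measure.pi μ) + l ^ 2 * (∑ i, c i ^ 2) / 8) := by
  refine (integral_exp_le_integral_exp_average μ f c l hf Finset.univ).trans (le_of_eq ?_)
  simp only [Finset.piecewise_univ, integral_const, probReal_univ, one_smul]
  rw [add_comm, Real.exp_add]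

/-- An exponential moment bound in two stages: the coordinates in `s` have bounded differences,
and those outside `s` have bounded differences after averaging over the coordinates in `s`. -/
theorem integral_exp_le_two_stage (μ : ∀ i, Measure (α i))
    [∀ i, IsProbabilityMeasure (μ i)] (f : (∀ i, α i) → ℝ) (s : Finset ι) (b c : ι → ℝ) (l : ℝ)
    (hb : ∀ i ω η, |f (({i} : Finset ι).piecewise η ω) - f ω| ≤ b i)
    (hc : ∀ i ∉ s, ∀ ω ζ, |∫ η, f (({i} : Finset ι).piecewise ζ (s.piecewise η ω))
      ∂Measure.pi μ - ∫ η, f (s.piecewise η ω) ∂Measure.pi μ| ≤ c i) :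
    ∫ ω, Real.exp (l * f ω) ∂Measure.pi μ ≤
      Real.exp (l * (∫ ω, f ω ∂Measure.pi μ) +
        l ^ 2 * (∑ i ∈ s, b i ^ 2 + ∑ i ∈ sᶜ, c i ^ 2) / 8) := by
  refine (integral_exp_le_integral_exp_average μ f b l hb s).trans ?_
  -- The averaged function no longer depends on the coordinates in `s`, so its constants there are
  -- `0`.
  have h := integral_exp_le μ (fun ω => ∫ η, f (s.piecewise η ω) ∂Measure.pi μ)
    (fun i => if i ∈ s then 0 else c i) l fun i ω ζ => ?_
  · refine (mul_le_mul_of_nonneg_left h (Real.exp_nonneg _)).trans (le_of_eq ?_)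
    rw [integral_integral_piecewise, ← Real.exp_add]
    have h2 : ∑ i, (if i ∈ s then (0 : ℝ) else c i) ^ 2 = ∑ i ∈ sᶜ, c i ^ 2 := by
      rw [← Finset.sum_add_sum_compl s, Finset.sum_eq_zero, zero_add]
      · exact Finset.sum_congr rfl fun i hi => by simp [Finset.mem_compl.1 hi]
      · intro i hi; simp [hi]
    rw [h2]
    congr 1
    ring
  · by_cases hi : i ∈ s
    · simp only [hi, if_true]
      have : ∀ η : ∀ i, α i, s.piecewise η (({i} : Finset ι).piecewise ζ ω) = s.piecewise η ω :=
        fun η => by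
          funext j
          by_cases hj : j ∈ s
          · simp [Finset.piecewise, hj]
          · have : j ≠ i := fun h => hj (h ▸ hi)
            simp [Finset.piecewise, hj, this]
      simp [this]
    · simp only [hi, if_false]
      have : ∀ η : ∀ i, α i, s.piecewise η (({i} : Finset ι).piecewise ζ ω) =
          ({i} : Finset ι).piecewise ζ (s.piecewise η ω) := fun η => by
        funext j
        by_cases hj : j = i
        · subst hj; simp [Finset.piecewise, hi]
        · by_cases hjs : j ∈ s <;> simp [Finset.piecewise, hj, hjs]
      simp only [this]
      exact hc i hi ω ζ

end ProductConcentration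

end

noncomputable section

namespace InitialColoring

universe u w

variable {V : Type u} [Fintype V] [DecidableEq V]
variable {G : SimpleGraph V} [DecidableRel G.Adj] {C : Type w}

/-! ### Elementary probabilities -/

/-- The probability that a vertex chooses a given color of its palette. -/
def hitProb (G : SimpleGraph V) [DecidableRel G.Adj] : ℝ :=
  1 / (100 * ((G.maxDegree : ℝ) + 1))

theorem hitProb_pos (G : SimpleGraph V) [DecidableRel G.Adj] : 0 < hitProb G := by
  unfold hitProb; positivity

theorem hitProb_mul (G : SimpleGraph V) [DecidableRel G.Adj] :
    hitProb G * ((G.maxDegree : ℝ) + 1) = 1 / 100 := by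
  unfold hitProb; field_simp

instance (L : Palettes G C) : IsProbabilityMeasure (tentativeLaw L) :=
  inferInstanceAs (IsProbabilityMeasure (Measure.pi _))

theorem integral_choiceLaw (L : Palettes G C) (v : V) (f : Choice L v → ℝ) :
    ∫ a, f a ∂(choiceLaw L v).toMeasure =
      99 / 100 * f (none : Option (L.pal v)) +
        ∑ x : L.pal v, hitProb G * f (some x : Option (L.pal v)) := by
  refine (PMF.integral_eq_sum (choiceLaw L v) f).trans ((Fintype.sum_option _).trans ?_)
  have h1 : ((choiceLaw L v) (none : Option (L.pal v))).toReal = 99 / 100 := by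
    change ((99 : ℝ≥0∞) / 100).toReal = _
    simp
  have h2 : ∀ x : L.pal v, ((choiceLaw L v) (some x : Option (L.pal v))).toReal = hitProb G := by
    intro x
    change ((1 / 100 : ℝ≥0∞) / ((G.maxDegree + 1 : ℕ) : ℝ≥0∞)).toReal = _
    rw [ENNReal.toReal_div, ENNReal.toReal_div, ENNReal.toReal_natCast]
    unfold hitProb
    rw [div_div]
    push_cast
    norm_num
  congr 1
  · exact congrArg (· * f (none : Option (L.pal v))) h1
  · exact Finset.sum_congr rfl fun x _ => congrArg (· * f (some x : Option (L.pal v))) (h2 x)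

/-- The color of a choice. -/
def choiceColor (L : Palettes G C) (v : V) (a : Choice L v) : Option C :=
  Option.map Subtype.val (show Option (L.pal v) from a)

variable [DecidableEq C]

theorem tentative_mem {L : Palettes G C} {ω : ∀ v, Choice L v} {x : V} {c : C}
    (h : tentative L ω x = some c) : c ∈ L.pal x := by
  unfold tentative at h
  rw [Option.map_eq_some_iff] at h
  obtain ⟨a, -, rfl⟩ := h
  exact a.2

/-- The indicator that `x` tentatively chooses `c`. -/
def hit (L : Palettes G C) (c : C) (x : V) (ω : ∀ v, Choice L v) : ℝ :=
  if tentative L ω x = some c then 1 else 0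

theorem hit_nonneg (L : Palettes G C) (c : C) (x : V) (ω : ∀ v, Choice L v) :
    0 ≤ hit L c x ω := by
  unfold hit; split_ifs <;> norm_num

theorem integral_prod_hit (L : Palettes G C) (c : C) (S : Finset V) :
    ∫ ω, ∏ x ∈ S, hit L c x ω ∂tentativeLaw L =
      ∏ x ∈ S, if c ∈ L.pal x then hitProb G else 0 := by
  classical
  have h1 : ∀ ω : ∀ v, Choice L v, ∏ x ∈ S, hit L c x ω = ∏ x : V,
      (fun (x : V) (a : Choice L x) => if x ∈ S then
        (if choiceColor L x a = some c then (1 : ℝ) else 0) else 1) x (ω x) := by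
    intro ω
    simp only
    rw [Finset.prod_ite_mem_eq]
    rfl
  simp_rw [h1]
  rw [tentativeLaw, integral_fintype_prod_eq_prod (fun (x : V) (a : Choice L x) => if x ∈ S then
        (if choiceColor L x a = some c then (1 : ℝ) else 0) else 1),
    ← Finset.prod_ite_mem_eq S (fun x => if c ∈ L.pal x then hitProb G else 0)]
  refine Finset.prod_congr rfl fun x _ => ?_
  by_cases hx : x ∈ S
  · simp only [hx, if_true]
    refine (integral_choiceLaw L x _).trans ?_
    simp only [choiceColor, Option.map_none, reduceCtorEq, if_false, mul_zero, zero_add,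
      Option.map_some, Option.some_inj]
    by_cases hc : c ∈ L.pal x
    · rw [Finset.sum_eq_single ⟨c, hc⟩]
      · simp [hc]
      · intro b _ hb
        have : (b : C) ≠ c := fun h => hb (Subtype.ext h)
        simp [this]
      · simp
    · rw [if_neg hc]
      refine Finset.sum_eq_zero fun b _ => ?_
      have : (b : C) ≠ c := fun h => hc (h ▸ b.2)
      simp [this]
  · simp [hx]

theorem integral_hit (L : Palettes G C) (c : C) (x : V) :
    ∫ ω, hit L c x ω ∂tentativeLaw L = if c ∈ L.pal x then hitProb G else 0 := by
  simpa using integral_prod_hit L c {x}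

theorem integral_hit_le (L : Palettes G C) (c : C) (x : V) :
    ∫ ω, hit L c x ω ∂tentativeLaw L ≤ hitProb G := by
  rw [integral_hit]
  split_ifs
  · exact le_rfl
  · exact (hitProb_pos G).le

/-! ### Colors that yield a surplus -/

/-- The neighbors of `v` with permanent color `c`. -/
def winners (L : Palettes G C) (ω : ∀ v, Choice L v) (v : V) (c : C) : Finset V :=
  (G.neighborFinset v).filter fun x => permanent L ω x = some c

/-- The number of neighbors of `v` that have to get the permanent color `c` for a surplus. -/
def threshold (L : Palettes G C) (v : V) (c : C) : ℕ := if c ∈ L.pal v then 2 else 1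

/-- The union of all palettes. -/
def allColors (L : Palettes G C) : Finset C := Finset.univ.biUnion L.pal

/-- The number of colors that yield a surplus at `v`. -/
def excess (L : Palettes G C) (ω : ∀ v, Choice L v) (v : V) : ℕ :=
  ((allColors L).filter fun c => threshold L v c ≤ (winners L ω v c).card).card

theorem pal_subset_allColors (L : Palettes G C) (v : V) : L.pal v ⊆ allColors L :=
  Finset.subset_biUnion_of_mem L.pal (Finset.mem_univ v)

theorem permanent_eq_some_iff {L : Palettes G C} {ω : ∀ v, Choice L v} {x : V} {c : C} :
    permanent L ω x = some c ↔
      tentative L ω x = some c ∧ ∀ y, G.Adj x y → tentative L ω y ≠ some c := by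
  unfold permanent
  split_ifs with h
  · simp only [false_iff, not_and, not_forall]
    obtain ⟨y, hy, hyx⟩ := h
    exact fun hc => ⟨y, hy, by simp [hyx, hc]⟩
  · push Not at h
    exact ⟨fun hc => ⟨hc, fun y hy => hc ▸ h y hy⟩, fun hc => hc.1⟩

theorem sum_card_winners (L : Palettes G C) (ω : ∀ v, Choice L v) (v : V) :
    ∑ c ∈ allColors L, (winners L ω v c).card + uncoloredDegree L ω v = G.degree v := by
  rw [← G.card_neighborFinset_eq_degree, ← Finset.card_filter_add_card_filter_not
    (s := G.neighborFinset v) (fun x => permanent L ω x = none), add_comm]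
  congr 1
  rw [← Finset.card_biUnion]
  · congr 1
    ext x
    simp only [Finset.mem_biUnion, winners, Finset.mem_filter]
    constructor
    · rintro ⟨c, -, hx, hc⟩
      exact ⟨hx, by simp [hc]⟩
    · rintro ⟨hx, hc⟩
      obtain ⟨c, hc⟩ := Option.ne_none_iff_exists'.1 hc
      exact ⟨c, pal_subset_allColors L x (tentative_mem (permanent_eq_some_iff.1 hc).1), hx, hc⟩
  · intro c _ c' _ hcc
    rw [Function.onFun, Finset.disjoint_left]
    intro x hx hx'
    simp only [winners, Finset.mem_filter] at hx hx'
    exact hcc (Option.some_inj.1 (hx.2.symm.trans hx'.2))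

theorem paletteSize_add (L : Palettes G C) (ω : ∀ v, Choice L v) (v : V) :
    paletteSize L ω v + ((L.pal v).filter fun c => (winners L ω v c).Nonempty).card =
      G.maxDegree + 1 := by
  rw [← L.card_pal v, ← Finset.card_filter_add_card_filter_not
    (s := L.pal v) (fun c => ∀ x, G.Adj v x → permanent L ω x ≠ some c)]
  congr 2
  ext c
  simp [winners, Finset.Nonempty]

/-- The surplus is at least the number of missing neighbors plus the number of colors that yield
a surplus. -/
theorem le_surplus (L : Palettes G C) (ω : ∀ v, Choice L v) (v : V) :
    (G.maxDegree : ℤ) + 1 - G.degree v + excess L ω v ≤ surplus L ω v := by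
  have h1 := sum_card_winners L ω v
  have h2 := paletteSize_add L ω v
  -- By `h1` and `h2` the surplus is `D + 1 - deg v` plus the sum over all colors of the number of
  -- winners, minus the number of palette colors won. It remains to compare color by color.
  have h3 : ((L.pal v).filter fun c => (winners L ω v c).Nonempty).card + excess L ω v ≤
      ∑ c ∈ allColors L, (winners L ω v c).card := by
    have : ((L.pal v).filter fun c => (winners L ω v c).Nonempty).card =
        ((allColors L).filter fun c => c ∈ L.pal v ∧ (winners L ω v c).Nonempty).card := by
      congr 1
      ext c
      simp only [Finset.mem_filter]
      exact ⟨fun h => ⟨pal_subset_allColors L v h.1, h⟩, fun h => h.2⟩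
    rw [this, excess, Finset.card_filter, Finset.card_filter, ← Finset.sum_add_distrib]
    refine Finset.sum_le_sum fun c _ => ?_
    simp only [threshold, ← Finset.card_pos]
    split_ifs <;> grind
  unfold surplus
  omega

/-! ### Concentration of the number of colors that yield a surplus -/

theorem winners_congr {L : Palettes G C} {ω ω' : ∀ v, Choice L v} {v : V} {c : C}
    (h : ∀ x ∈ G.neighborFinset v, (permanent L ω x = some c ↔ permanent L ω' x = some c)) :
    winners L ω v c = winners L ω' v c :=
  Finset.filter_congr h

theorem abs_excess_sub_le_card (L : Palettes G C) (ω ω' : ∀ v, Choice L v) (v : V) :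
    |(excess L ω v : ℝ) - excess L ω' v| ≤
      (((allColors L).filter fun c => winners L ω v c ≠ winners L ω' v c).card : ℝ) := by
  simp only [excess, Finset.card_filter, Nat.cast_sum, ← Finset.sum_sub_distrib]
  refine (Finset.abs_sum_le_sum_abs _ _).trans (Finset.sum_le_sum fun c _ => ?_)
  by_cases h : winners L ω v c = winners L ω' v c
  · simp [h]
  · simp only [ne_eq, h, not_false_eq_true, if_true]
    split_ifs <;> norm_num

/-- Only the old and the new tentative color of `x` can change their sets of winners. -/
theorem abs_excess_sub_le_two {L : Palettes G C} {ω ω' : ∀ v, Choice L v} (v x : V)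
    (h : ∀ y ≠ x, ω y = ω' y) : |(excess L ω v : ℝ) - excess L ω' v| ≤ 2 := by
  refine (abs_excess_sub_le_card L ω ω' v).trans ?_
  have hsub : ((allColors L).filter fun c => winners L ω v c ≠ winners L ω' v c).image some ⊆
      {tentative L ω x, tentative L ω' x} := by
    intro o ho
    simp only [Finset.mem_image, Finset.mem_filter] at ho
    obtain ⟨c, ⟨-, hc⟩, rfl⟩ := ho
    by_contra hn
    simp only [Finset.mem_insert, Finset.mem_singleton, not_or] at hn
    have key : ∀ y, tentative L ω y = some c ↔ tentative L ω' y = some c := fun y => by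
      by_cases hy : y = x
      · subst hy
        exact iff_of_false (fun e => hn.1 e.symm) (fun e => hn.2 e.symm)
      · unfold tentative; rw [h y hy]
    exact hc (winners_congr fun y _ => by simp only [permanent_eq_some_iff, ne_eq, key])
  have h1 := Finset.card_le_card hsub
  rw [Finset.card_image_of_injective _ (Option.some_injective C)] at h1
  exact_mod_cast h1.trans Finset.card_le_two

/-- The indicator that `x` tentatively chooses `o`, where `o` is a color. -/
def optHit (L : Palettes G C) (o : Option C) (x : V) (ω : ∀ v, Choice L v) : ℝ :=
  o.elim 0 fun c => hit L c x ω

theorem optHit_nonneg (L : Palettes G C) (o : Option C) (x : V) (ω : ∀ v, Choice L v) :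
    0 ≤ optHit L o x ω := by
  cases o
  · exact le_rfl
  · exact hit_nonneg L _ x ω

theorem integral_optHit_le (L : Palettes G C) (o : Option C) (x : V) :
    ∫ ω, optHit L o x ω ∂tentativeLaw L ≤ hitProb G := by
  cases o
  · simpa [optHit] using (hitProb_pos G).le
  · exact integral_hit_le L _ x

/-- A vertex `x` outside `N(v)` is never a winner; it can only veto its color at common neighbors
that chose the same color. The right side depends on the choices in `N(v)` and the two colors of
`x`, so it can be averaged over `N(v)`. -/
theorem abs_excess_sub_le_sum {L : Palettes G C} {ω ω' : ∀ v, Choice L v} {v x : V}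
    (hx : x ∉ G.neighborFinset v) (h : ∀ y ≠ x, ω y = ω' y) :
    |(excess L ω v : ℝ) - excess L ω' v| ≤
      ∑ y ∈ G.neighborFinset v ∩ G.neighborFinset x,
        (optHit L (tentative L ω x) y ω + optHit L (tentative L ω' x) y ω) := by
  refine (abs_excess_sub_le_card L ω ω' v).trans ?_
  set W := (G.neighborFinset v ∩ G.neighborFinset x).filter fun y =>
    ∃ c, tentative L ω y = some c ∧ (tentative L ω x = some c ∨ tentative L ω' x = some c) with hW
  have ht : ∀ y ≠ x, tentative L ω y = tentative L ω' y := fun y hy => by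
    unfold tentative; rw [h y hy]
  have hsub : ((allColors L).filter fun c => winners L ω v c ≠ winners L ω' v c).image some ⊆
      W.image (tentative L ω) := by
    intro o ho
    simp only [Finset.mem_image, Finset.mem_filter] at ho
    obtain ⟨c, ⟨-, hc⟩, rfl⟩ := ho
    by_contra hn
    refine hc (winners_congr fun y hy => ?_)
    have hyx : y ≠ x := fun e => hx (e ▸ hy)
    rw [permanent_eq_some_iff, permanent_eq_some_iff, ← ht y hyx]
    refine and_congr_right fun hyc => forall₂_congr fun z hz => ?_
    by_cases hzx : z = x
    · subst hzx
      have hn' : ¬ (tentative L ω z = some c ∨ tentative L ω' z = some c) := fun hor =>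
        hn (Finset.mem_image.2 ⟨y, Finset.mem_filter.2
          ⟨Finset.mem_inter.2 ⟨hy, (G.mem_neighborFinset z y).2 hz.symm⟩, c, hyc, hor⟩, hyc⟩)
      rw [not_or] at hn'
      exact iff_of_true hn'.1 hn'.2
    · rw [ht z hzx]
  have h1 := Finset.card_le_card hsub
  rw [Finset.card_image_of_injective _ (Option.some_injective C)] at h1
  have h2 : (W.card : ℝ) ≤ ∑ y ∈ G.neighborFinset v ∩ G.neighborFinset x,
        (optHit L (tentative L ω x) y ω + optHit L (tentative L ω' x) y ω) := by
    rw [hW, Finset.card_filter, Nat.cast_sum]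
    refine Finset.sum_le_sum fun y _ => ?_
    have n1 := optHit_nonneg L (tentative L ω x) y ω
    have n2 := optHit_nonneg L (tentative L ω' x) y ω
    split_ifs with hy
    · obtain ⟨c, hyc, hc | hc⟩ := hy
      · have : optHit L (tentative L ω x) y ω = 1 := by simp [optHit, hc, hit, hyc]
        push_cast; linarith
      · have : optHit L (tentative L ω' x) y ω = 1 := by simp [optHit, hc, hit, hyc]
        push_cast; linarith
    · push_cast; linarith
  exact le_trans (by exact_mod_cast h1.trans Finset.card_image_le) h2

/-- Count the walks of length two from `v`. -/
theorem sum_card_inter_neighborFinset_le (G : SimpleGraph V) [DecidableRel G.Adj] (v : V) :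
    ∑ x, (G.neighborFinset v ∩ G.neighborFinset x).card ≤ G.maxDegree * G.maxDegree := by
  have h : ∀ x, (G.neighborFinset v ∩ G.neighborFinset x).card =
      ∑ y ∈ G.neighborFinset v, if G.Adj y x then 1 else 0 := fun x => by
    rw [← Finset.card_filter]
    congr 1
    ext y
    simp [G.adj_comm x y]
  simp_rw [h]
  rw [Finset.sum_comm]
  have h2 : ∀ y ∈ G.neighborFinset v, ∑ x, (if G.Adj y x then 1 else 0) ≤ G.maxDegree :=
    fun y _ => by
      rw [← Finset.card_filter, ← G.neighborFinset_eq_filter, G.card_neighborFinset_eq_degree]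
      exact G.degree_le_maxDegree y
  refine (Finset.sum_le_card_nsmul _ _ _ h2).trans ?_
  rw [smul_eq_mul, G.card_neighborFinset_eq_degree]
  exact Nat.mul_le_mul_right _ (G.degree_le_maxDegree v)

/-- The two stages are `N(v)` and its complement. The former contributes at most `4D` to the sum of
squares; the latter at most `4q²D · D² ≤ D`, because `qD ≤ 1/100`. -/
theorem integral_exp_excess_le (L : Palettes G C) (v : V) (l : ℝ) :
    ∫ ω, Real.exp (l * excess L ω v) ∂tentativeLaw L ≤
      Real.exp (l * (∫ ω, (excess L ω v : ℝ) ∂tentativeLaw L) + l ^ 2 * G.maxDegree) := by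
  set s := G.neighborFinset v with hs
  set q := hitProb G with hq
  have hq0 : 0 < q := hitProb_pos G
  have hoff : ∀ (x : V) (ω η : ∀ v, Choice L v), ∀ y ≠ x,
      ({x} : Finset V).piecewise η ω y = ω y := fun x ω η y hy => by
    simp [Finset.piecewise, hy]
  have h := ProductConcentration.integral_exp_le_two_stage (fun v => (choiceLaw L v).toMeasure)
    (fun ω => (excess L ω v : ℝ)) s (fun _ => 2)
    (fun x => 2 * q * (s ∩ G.neighborFinset x).card) l
    (fun x ω η => abs_excess_sub_le_two v x (hoff x ω η)) fun x hx ω ζ => ?_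
  · refine h.trans (Real.exp_le_exp.2 (add_le_add le_rfl ?_))
    rw [mul_div_assoc]
    refine mul_le_mul_of_nonneg_left ?_ (sq_nonneg l)
    have hD : (0 : ℝ) ≤ G.maxDegree := Nat.cast_nonneg _
    have hcs : (s.card : ℝ) ≤ G.maxDegree := by
      rw [hs, G.card_neighborFinset_eq_degree]
      exact_mod_cast G.degree_le_maxDegree v
    have h1 : ∑ _i ∈ s, (2 : ℝ) ^ 2 ≤ 4 * G.maxDegree := by
      rw [Finset.sum_const, nsmul_eq_mul]; linarith
    have hqD : q * G.maxDegree ≤ 1 / 100 := by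
      have := hitProb_mul G
      rw [← hq] at this
      nlinarith
    have h2 : ∑ x ∈ sᶜ, (2 * q * ((s ∩ G.neighborFinset x).card : ℝ)) ^ 2 ≤
        (4 * q ^ 2 * G.maxDegree) * ((G.maxDegree : ℝ) * G.maxDegree) := by
      calc ∑ x ∈ sᶜ, (2 * q * ((s ∩ G.neighborFinset x).card : ℝ)) ^ 2
          ≤ ∑ x, (2 * q * ((s ∩ G.neighborFinset x).card : ℝ)) ^ 2 :=
            Finset.sum_le_sum_of_subset_of_nonneg (Finset.subset_univ _)
              fun _ _ _ => sq_nonneg _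
        _ ≤ ∑ x, (4 * q ^ 2 * G.maxDegree) * ((s ∩ G.neighborFinset x).card : ℝ) := by
            refine Finset.sum_le_sum fun x _ => ?_
            have : ((s ∩ G.neighborFinset x).card : ℝ) ≤ G.maxDegree :=
              le_trans (by exact_mod_cast Finset.card_le_card Finset.inter_subset_left) hcs
            have h0 : (0 : ℝ) ≤ ((s ∩ G.neighborFinset x).card : ℝ) := Nat.cast_nonneg _
            have := mul_le_mul_of_nonneg_left (mul_le_mul_of_nonneg_right this h0)
              (by positivity : 0 ≤ 4 * q ^ 2)
            linarith
        _ ≤ _ := by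
            rw [← Finset.mul_sum]
            refine mul_le_mul_of_nonneg_left ?_ (by positivity)
            exact_mod_cast sum_card_inter_neighborFinset_le G v
    have h3 : (4 * q ^ 2 * G.maxDegree) * ((G.maxDegree : ℝ) * G.maxDegree) ≤ G.maxDegree := by
      have h4 : (q * G.maxDegree) ^ 2 ≤ (1 / 100) ^ 2 :=
        pow_le_pow_left₀ (by positivity) hqD 2
      have := mul_le_mul_of_nonneg_right h4 hD
      linarith
    exact (div_le_div_of_nonneg_right (add_le_add h1 (h2.trans h3)) (by norm_num)).trans
      (by linarith)
  · change |∫ η, _ ∂tentativeLaw L - ∫ η, _ ∂tentativeLaw L| ≤ _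
    rw [← integral_sub Integrable.of_finite Integrable.of_finite]
    refine abs_integral_le_integral_abs.trans ?_
    set o := tentative L ω x
    set o' := tentative L (({x} : Finset V).piecewise ζ ω) x
    calc ∫ η, |(excess L (({x} : Finset V).piecewise ζ (s.piecewise η ω)) v : ℝ) -
          excess L (s.piecewise η ω) v| ∂tentativeLaw L
        ≤ ∫ η, ∑ y ∈ s ∩ G.neighborFinset x, (optHit L o y η + optHit L o' y η)
            ∂tentativeLaw L := by
          refine integral_mono Integrable.of_finite Integrable.of_finite fun η => ?_
          simp only
          rw [abs_sub_comm]
          refine (abs_excess_sub_le_sum hx fun y hy => (hoff x _ ζ y hy).symm).trans (le_of_eq ?_)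
          have e1 : tentative L (s.piecewise η ω) x = o := by
            simp only [tentative, o, Finset.piecewise, if_neg hx]
          have e2 : tentative L (({x} : Finset V).piecewise ζ (s.piecewise η ω)) x = o' := by
            simp [tentative, o', Finset.piecewise]
          rw [e1, e2]
          refine Finset.sum_congr rfl fun y hy => ?_
          have hys : y ∈ s := (Finset.mem_inter.1 hy).1
          have e3 : tentative L (s.piecewise η ω) y = tentative L η y := by
            simp only [tentative, Finset.piecewise, if_pos hys]
          simp only [optHit, hit, e3]
      _ ≤ ∑ y ∈ s ∩ G.neighborFinset x, (q + q) := by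
          rw [integral_finsetSum _ fun _ _ => Integrable.of_finite]
          refine Finset.sum_le_sum fun y _ => ?_
          rw [integral_add Integrable.of_finite Integrable.of_finite]
          exact add_le_add (integral_optHit_le L o y) (integral_optHit_le L o' y)
      _ = 2 * q * (s ∩ G.neighborFinset x).card := by
          rw [Finset.sum_const, nsmul_eq_mul]; ring

/-! ### The expected number of colors that yield a surplus -/

/-- Sets of `threshold L v c` independent neighbors of `v` that have `c` in their palettes. -/
def candidates (L : Palettes G C) (v : V) (c : C) : Finset (Finset V) :=
  ((G.neighborFinset v).powersetCard (threshold L v c)).filter fun S =>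
    (∀ x ∈ S, c ∈ L.pal x) ∧ ∀ x ∈ S, ∀ y ∈ S, ¬ G.Adj x y

theorem threshold_le_two (L : Palettes G C) (v : V) (c : C) : threshold L v c ≤ 2 := by
  unfold threshold; split_ifs <;> norm_num

/-- A pointwise lower bound for the indicator whose expectation involves only products of hits. The
term of `S` is positive only if all of `S` and no other vertex of `N(v)` or `N(S)` chose `c`; then
all of `S` wins. -/
theorem sum_candidates_le (L : Palettes G C) (v : V) (c : C) (ω : ∀ v, Choice L v) :
    ∑ S ∈ candidates L v c, (∏ x ∈ S, hit L c x ω) *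
      (1 - ∑ y ∈ (G.neighborFinset v ∪ S.biUnion fun x => G.neighborFinset x) \ S, hit L c y ω) ≤
      if threshold L v c ≤ (winners L ω v c).card then 1 else 0 := by
  set T := (G.neighborFinset v).filter fun x => tentative L ω x = some c with hT
  set r : ℝ := if threshold L v c ≤ (winners L ω v c).card then 1 else 0 with hr
  have hr0 : 0 ≤ r := by rw [hr]; split_ifs <;> norm_num
  have hterm : ∀ S ∈ candidates L v c, (∏ x ∈ S, hit L c x ω) *
      (1 - ∑ y ∈ (G.neighborFinset v ∪ S.biUnion fun x => G.neighborFinset x) \ S, hit L c y ω) ≤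
      if S = T then r else 0 := by
    intro S hS
    have hrhs : 0 ≤ if S = T then r else 0 := by split_ifs <;> simp [hr0]
    set B := (G.neighborFinset v ∪ S.biUnion fun x => G.neighborFinset x) \ S with hB
    have hprod0 : 0 ≤ ∏ x ∈ S, hit L c x ω := Finset.prod_nonneg fun x _ => hit_nonneg L c x ω
    by_cases h1 : ∃ y ∈ B, tentative L ω y = some c
    · obtain ⟨y, hy, hyc⟩ := h1
      have : hit L c y ω ≤ ∑ y ∈ B, hit L c y ω :=
        Finset.single_le_sum (fun x _ => hit_nonneg L c x ω) hy
      have hy1 : hit L c y ω = 1 := by simp [hit, hyc]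
      exact (mul_nonpos_of_nonneg_of_nonpos hprod0 (by linarith)).trans hrhs
    · by_cases h2 : ∃ x ∈ S, tentative L ω x ≠ some c
      · obtain ⟨x, hx, hxc⟩ := h2
        rw [Finset.prod_eq_zero hx (by simp [hit, hxc]), zero_mul]
        exact hrhs
      · push Not at h1 h2
        simp only [candidates, Finset.mem_filter, Finset.mem_powersetCard] at hS
        obtain ⟨⟨hSN, hSc⟩, -, hind⟩ := hS
        -- This identifies `S` with the set of all neighbors choosing `c`, so at most one `S`
        -- contributes to the sum.
        have hST : S = T := by
          ext y
          simp only [hT, Finset.mem_filter]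
          refine ⟨fun hy => ⟨hSN hy, h2 y hy⟩, fun hy => ?_⟩
          by_contra hyS
          exact h1 y (Finset.mem_sdiff.2 ⟨Finset.mem_union_left _ hy.1, hyS⟩) hy.2
        have hSW : S ⊆ winners L ω v c := by
          intro x hx
          simp only [winners, Finset.mem_filter]
          refine ⟨hSN hx, permanent_eq_some_iff.2 ⟨h2 x hx, fun y hy => ?_⟩⟩
          exact h1 y (Finset.mem_sdiff.2 ⟨Finset.mem_union_right _
            (Finset.mem_biUnion.2 ⟨x, hx, (G.mem_neighborFinset x y).2 hy⟩),
            fun hyS => hind x hx y hyS hy⟩)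
        have hr1 : r = 1 := by rw [hr, if_pos (hSc ▸ Finset.card_le_card hSW)]
        rw [if_pos hST, hr1, Finset.prod_eq_one fun x hx => by simp [hit, h2 x hx], one_mul]
        have := Finset.sum_nonneg fun y (_ : y ∈ B) => hit_nonneg L c y ω
        linarith
  refine (Finset.sum_le_sum hterm).trans ?_
  rw [Finset.sum_ite_eq']
  split_ifs <;> simp [hr0]

/-- Since `S` has at most two elements, at most `3D` vertices can spoil it, each with conditional
probability at most `q`; the loss is a factor of at least `1 - 3/100`. -/
theorem card_candidates_le_integral (L : Palettes G C) (v : V) (c : C) :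
    97 / 100 * ((candidates L v c).card * hitProb G ^ threshold L v c) ≤
      ∫ ω, (if threshold L v c ≤ (winners L ω v c).card then (1 : ℝ) else 0) ∂tentativeLaw L := by
  set q := hitProb G with hq
  have hq0 : 0 < q := hitProb_pos G
  set k := threshold L v c with hk
  have hqD : q * G.maxDegree ≤ 1 / 100 := by
    have := hitProb_mul G
    rw [← hq] at this
    nlinarith
  refine le_trans ?_ (integral_mono Integrable.of_finite Integrable.of_finite
    fun ω => sum_candidates_le L v c ω)
  rw [integral_finsetSum _ fun _ _ => Integrable.of_finite]
  have hterm : ∀ S ∈ candidates L v c, 97 / 100 * q ^ k ≤ ∫ ω, (∏ x ∈ S, hit L c x ω) *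
      (1 - ∑ y ∈ (G.neighborFinset v ∪ S.biUnion fun x => G.neighborFinset x) \ S, hit L c y ω)
      ∂tentativeLaw L := by
    intro S hS
    simp only [candidates, Finset.mem_filter, Finset.mem_powersetCard] at hS
    obtain ⟨⟨hSN, hSc⟩, hpal, hind⟩ := hS
    set B := (G.neighborFinset v ∪ S.biUnion fun x => G.neighborFinset x) \ S with hB
    have hBcard : (B.card : ℝ) ≤ 3 * G.maxDegree := by
      have h1 : B.card ≤ G.maxDegree + 2 * G.maxDegree := by
        refine (Finset.card_le_card Finset.sdiff_subset).trans ((Finset.card_union_le _ _).trans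
          (add_le_add ?_ (Finset.card_biUnion_le.trans ((Finset.sum_le_card_nsmul _ _ G.maxDegree
            fun x _ => ?_).trans ?_))))
        · rw [G.card_neighborFinset_eq_degree]; exact G.degree_le_maxDegree v
        · rw [G.card_neighborFinset_eq_degree]; exact G.degree_le_maxDegree x
        · rw [smul_eq_mul, hSc]
          exact Nat.mul_le_mul_right _ (threshold_le_two L v c)
      have : (B.card : ℝ) ≤ G.maxDegree + 2 * G.maxDegree := by exact_mod_cast h1
      linarith
    have hprod : ∏ x ∈ S, (if c ∈ L.pal x then q else 0) = q ^ k := by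
      rw [Finset.prod_congr rfl fun x hx => if_pos (hpal x hx), Finset.prod_const, hSc]
    have hexp : ∀ ω, (∏ x ∈ S, hit L c x ω) * (1 - ∑ y ∈ B, hit L c y ω) =
        (∏ x ∈ S, hit L c x ω) - ∑ y ∈ B, ∏ x ∈ insert y S, hit L c x ω := fun ω => by
      rw [mul_sub, mul_one, Finset.mul_sum]
      congr 1
      refine Finset.sum_congr rfl fun y hy => ?_
      rw [Finset.prod_insert (Finset.mem_sdiff.1 hy).2, mul_comm]
    simp_rw [hexp]
    rw [integral_sub Integrable.of_finite Integrable.of_finite,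
      integral_finsetSum _ fun _ _ => Integrable.of_finite, integral_prod_hit, hprod]
    have hy : ∀ y ∈ B, ∫ ω, ∏ x ∈ insert y S, hit L c x ω ∂tentativeLaw L ≤ q * q ^ k := by
      intro y hy
      rw [integral_prod_hit, Finset.prod_insert (Finset.mem_sdiff.1 hy).2, hprod]
      refine mul_le_mul_of_nonneg_right ?_ (by positivity)
      split_ifs
      · exact le_rfl
      · exact hq0.le
    have hsum := Finset.sum_le_card_nsmul _ _ _ hy
    rw [nsmul_eq_mul] at hsum
    have hqk : 0 < q ^ k := by positivity
    have h5 : (B.card : ℝ) * (q * q ^ k) ≤ 3 / 100 * q ^ k := by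
      have h6 : (B.card : ℝ) * q ≤ 3 / 100 := by nlinarith
      have := mul_le_mul_of_nonneg_right h6 hqk.le
      linarith
    linarith
  have := Finset.card_nsmul_le_sum _ _ _ hterm
  rw [nsmul_eq_mul] at this
  linarith

theorem sum_candidates_le_integral_excess (L : Palettes G C) (v : V) :
    97 / 100 * ∑ c ∈ allColors L, ((candidates L v c).card * hitProb G ^ threshold L v c) ≤
      ∫ ω, (excess L ω v : ℝ) ∂tentativeLaw L := by
  have : ∀ ω, (excess L ω v : ℝ) = ∑ c ∈ allColors L,
      if threshold L v c ≤ (winners L ω v c).card then (1 : ℝ) else 0 := fun ω => by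
    rw [excess, Finset.card_filter]; push_cast; rfl
  simp_rw [this]
  rw [integral_finsetSum _ fun _ _ => Integrable.of_finite, Finset.mul_sum]
  exact Finset.sum_le_sum fun c _ => card_candidates_le_integral L v c

/-- Ordered pairs of distinct nonadjacent neighbors of `v`. -/
def nonadjacentPairs (G : SimpleGraph V) [DecidableRel G.Adj] (v : V) : Finset (V × V) :=
  (G.neighborFinset v ×ˢ G.neighborFinset v).filter fun p => p.1 ≠ p.2 ∧ ¬ G.Adj p.1 p.2

theorem card_le_card_candidates_of_notMem {L : Palettes G C} {v : V} {c : C}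
    (hc : c ∉ L.pal v) :
    ((G.neighborFinset v).filter fun x => c ∈ L.pal x).card ≤ (candidates L v c).card := by
  refine Finset.card_le_card_of_injOn (fun x => {x}) (fun x hx => ?_)
    (Finset.singleton_injective.injOn)
  simp only [Finset.coe_filter, Set.mem_ofPred_eq] at hx
  simp [candidates, threshold, hc, hx.2, Finset.mem_powersetCard, hx.1]

/-- The factor 2 passes from ordered to unordered pairs. -/
theorem card_le_card_candidates_of_mem {L : Palettes G C} {v : V} {c : C} (hc : c ∈ L.pal v) :
    ((nonadjacentPairs G v).filter fun p => c ∈ L.pal p.1 ∧ c ∈ L.pal p.2).card ≤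
      2 * (candidates L v c).card := by
  refine Finset.card_le_mul_card_image_of_maps_to (f := fun p : V × V => ({p.1, p.2} : Finset V))
    (fun p hp => ?_) 2 fun S hS => ?_
  · simp only [nonadjacentPairs, Finset.mem_filter, Finset.mem_product] at hp
    obtain ⟨⟨⟨h1, h2⟩, hne, hadj⟩, hp1, hp2⟩ := hp
    simp only [candidates, Finset.mem_filter, Finset.mem_powersetCard, threshold, hc, if_true]
    refine ⟨⟨Finset.insert_subset h1 (Finset.singleton_subset_iff.2 h2),
      Finset.card_pair hne⟩, ?_, ?_⟩
    · simp [hp1, hp2]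
    · simp [hadj, G.adj_comm p.2 p.1]
  · by_cases hne : ∃ p ∈ nonadjacentPairs G v, ({p.1, p.2} : Finset V) = S
    · obtain ⟨⟨a, b⟩, -, rfl⟩ := hne
      refine (Finset.card_le_card (t := {(a, b), (b, a)}) fun p hp => ?_).trans Finset.card_le_two
      simp only [nonadjacentPairs, Finset.mem_filter] at hp
      have h0 := hp.1.1.2.1
      have h1 : p.1 ∈ ({a, b} : Finset V) := hp.2 ▸ by simp
      have h2 : p.2 ∈ ({a, b} : Finset V) := hp.2 ▸ by simp
      simp only [Finset.mem_insert, Finset.mem_singleton, Prod.ext_iff] at h1 h2 ⊢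
      grind
    · rw [Finset.card_eq_zero.2]
      · norm_num
      · refine Finset.filter_eq_empty_iff.2 fun p hp h => hne ⟨p, (Finset.mem_filter.1 hp).1, h⟩

/-- The expected number of colors that yield a surplus at `v` is at least proportional to the
number of nonadjacent pairs of neighbors of `v`. -/
theorem card_nonadjacentPairs_le_integral_excess (L : Palettes G C) (v : V) :
    97 / 20000 * hitProb G * (nonadjacentPairs G v).card ≤
      ∫ ω, (excess L ω v : ℝ) ∂tentativeLaw L := by
  refine le_trans ?_ (sum_candidates_le_integral_excess L v)
  set q := hitProb G with hq
  have hq0 : 0 < q := hitProb_pos G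
  have hqD1 := hitProb_mul G
  rw [← hq] at hqD1
  set N := G.neighborFinset v with hN
  set P := nonadjacentPairs G v with hP
  set a : V → ℝ := fun x => ((L.pal x \ L.pal v).card : ℝ) with ha
  -- `T` measures how far the neighbors' palettes deviate from `Pal(v)`. Deviation reduces the gain
  -- from colors in `Pal(v)` but creates gain from colors outside it.
  set T : ℝ := ∑ x ∈ N, a x with hT
  have hT0 : 0 ≤ T := Finset.sum_nonneg fun _ _ => Nat.cast_nonneg _
  have hNcard : (N.card : ℝ) ≤ G.maxDegree := by
    rw [hN, G.card_neighborFinset_eq_degree]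
    exact_mod_cast G.degree_le_maxDegree v
  have hsplit := Finset.sum_filter_add_sum_filter_not (allColors L) (fun c => c ∈ L.pal v)
    (fun c => ((candidates L v c).card : ℝ) * q ^ threshold L v c)
  have hfilter : (allColors L).filter (fun c => c ∈ L.pal v) = L.pal v := by
    ext c
    simp only [Finset.mem_filter]
    exact ⟨fun h => h.2, fun h => ⟨pal_subset_allColors L v h, h⟩⟩
  have hout : T * q ≤ ∑ c ∈ (allColors L).filter (fun c => c ∉ L.pal v),
      ((candidates L v c).card : ℝ) * q ^ threshold L v c := by
    have e1 : T = ∑ c ∈ (allColors L).filter (fun c => c ∉ L.pal v),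
        ((N.filter fun x => c ∈ L.pal x).card : ℝ) := by
      simp only [hT, ha, Finset.card_filter]
      push_cast
      rw [Finset.sum_comm]
      refine Finset.sum_congr rfl fun x _ => ?_
      rw [Finset.sum_boole]
      congr 2
      ext c
      simp only [Finset.mem_sdiff, Finset.mem_filter]
      exact ⟨fun h => ⟨⟨pal_subset_allColors L x h.1, h.2⟩, h.1⟩, fun h => ⟨h.2, h.1.2⟩⟩
    rw [e1, Finset.sum_mul]
    refine Finset.sum_le_sum fun c hc => ?_
    have hc' := (Finset.mem_filter.1 hc).2
    have : threshold L v c = 1 := by simp [threshold, hc']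
    rw [this, pow_one]
    refine mul_le_mul_of_nonneg_right ?_ hq0.le
    exact_mod_cast card_le_card_candidates_of_notMem hc'
  have hin : (P.card * ((G.maxDegree : ℝ) + 1) - 2 * G.maxDegree * T) * (q ^ 2 / 2) ≤
      ∑ c ∈ L.pal v, ((candidates L v c).card : ℝ) * q ^ threshold L v c := by
    have e1 : (P.card * ((G.maxDegree : ℝ) + 1) - 2 * G.maxDegree * T) ≤
        ∑ c ∈ L.pal v, ((P.filter fun p => c ∈ L.pal p.1 ∧ c ∈ L.pal p.2).card : ℝ) := by
      have e2 : ∑ c ∈ L.pal v, ((P.filter fun p => c ∈ L.pal p.1 ∧ c ∈ L.pal p.2).card : ℝ) =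
          ∑ p ∈ P, (((L.pal v).filter fun c => c ∈ L.pal p.1 ∧ c ∈ L.pal p.2).card : ℝ) := by
        simp only [Finset.card_filter]
        push_cast
        rw [Finset.sum_comm]
      -- All palettes have equal size, so colors missing from `Pal(x)` are matched in number by
      -- colors outside `Pal(v)`.
      have e3 : ∀ x, (L.pal v \ L.pal x).card = (L.pal x \ L.pal v).card := fun x => by
        have h1 := Finset.card_sdiff_add_card_inter (L.pal v) (L.pal x)
        have h2 := Finset.card_sdiff_add_card_inter (L.pal x) (L.pal v)
        rw [Finset.inter_comm] at h2
        rw [L.card_pal] at h1 h2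
        omega
      have e4 : ∀ p ∈ P, ((G.maxDegree : ℝ) + 1) - a p.1 - a p.2 ≤
          (((L.pal v).filter fun c => c ∈ L.pal p.1 ∧ c ∈ L.pal p.2).card : ℝ) := by
        intro p _
        have h1 : L.pal v ⊆ ((L.pal v).filter fun c => c ∈ L.pal p.1 ∧ c ∈ L.pal p.2) ∪
            ((L.pal v \ L.pal p.1) ∪ (L.pal v \ L.pal p.2)) := by
          intro c hc
          simp only [Finset.mem_union, Finset.mem_filter, Finset.mem_sdiff, hc, true_and]
          tauto
        have h2 := (Finset.card_le_card h1).trans ((Finset.card_union_le _ _).trans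
          (Nat.add_le_add_left (Finset.card_union_le _ _) _))
        rw [L.card_pal, e3, e3] at h2
        have h3 : ((G.maxDegree : ℝ) + 1) ≤
          (((L.pal v).filter fun c => c ∈ L.pal p.1 ∧ c ∈ L.pal p.2).card : ℝ) +
            (a p.1 + a p.2) := by
          simp only [ha]
          exact_mod_cast h2
        linarith
      have hPsub : P ⊆ N ×ˢ N := Finset.filter_subset _ _
      have e5 : ∑ p ∈ P, a p.1 ≤ G.maxDegree * T := by
        refine (Finset.sum_le_sum_of_subset_of_nonneg hPsub
          fun _ _ _ => Nat.cast_nonneg _).trans ?_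
        rw [Finset.sum_product]
        simp only [Finset.sum_const, nsmul_eq_mul, ← Finset.mul_sum]
        exact mul_le_mul_of_nonneg_right hNcard hT0
      have e6 : ∑ p ∈ P, a p.2 ≤ G.maxDegree * T := by
        refine (Finset.sum_le_sum_of_subset_of_nonneg hPsub
          fun _ _ _ => Nat.cast_nonneg _).trans ?_
        rw [Finset.sum_product]
        simp only [Finset.sum_const, nsmul_eq_mul]
        exact mul_le_mul_of_nonneg_right hNcard hT0
      have e7 := Finset.sum_le_sum e4
      rw [Finset.sum_sub_distrib, Finset.sum_sub_distrib, Finset.sum_const, nsmul_eq_mul] at e7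
      rw [e2]
      linarith
    refine (mul_le_mul_of_nonneg_right e1 (by positivity)).trans ?_
    rw [Finset.sum_mul]
    refine Finset.sum_le_sum fun c hc => ?_
    have : threshold L v c = 2 := by simp [threshold, hc]
    rw [this]
    have h1 : ((P.filter fun p => c ∈ L.pal p.1 ∧ c ∈ L.pal p.2).card : ℝ) ≤
        2 * (candidates L v c).card := by exact_mod_cast card_le_card_candidates_of_mem hc
    have := mul_le_mul_of_nonneg_right h1 (by positivity : 0 ≤ q ^ 2 / 2)
    linarith
  rw [hfilter] at hsplit
  rw [← hsplit]
  have hqD : q * G.maxDegree ≤ 1 := by linarith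
  have h1 : (P.card * ((G.maxDegree : ℝ) + 1) - 2 * G.maxDegree * T) * (q ^ 2 / 2) =
      q * P.card / 200 - q * T * (q * G.maxDegree) := by
    have : (P.card * ((G.maxDegree : ℝ) + 1) - 2 * G.maxDegree * T) * (q ^ 2 / 2) =
        q * P.card * (q * ((G.maxDegree : ℝ) + 1)) / 2 - q * T * (q * G.maxDegree) := by ring
    rw [this, hqD1]; ring
  -- The loss inside `Pal(v)` is covered by the gain `T * q` outside, leaving `q * P.card / 200`.
  have h2 : q * T * (q * G.maxDegree) ≤ q * T :=
    mul_le_of_le_one_right (mul_nonneg hq0.le hT0) hqD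
  linarith

/-! ### The residual palette -/

/-- The number of neighbors of `v` that choose a tentative color. -/
def activeDegree (L : Palettes G C) (ω : ∀ v, Choice L v) (v : V) : ℕ :=
  ((G.neighborFinset v).filter fun x => tentative L ω x ≠ none).card

/-- Distinct colors lost from the palette are chosen by distinct neighbors. -/
theorem le_paletteSize_add_activeDegree (L : Palettes G C) (ω : ∀ v, Choice L v) (v : V) :
    G.maxDegree + 1 ≤ paletteSize L ω v + activeDegree L ω v := by
  rw [← paletteSize_add L ω v]
  refine Nat.add_le_add_left ?_ _
  have hsub : ((L.pal v).filter fun c => (winners L ω v c).Nonempty).image some ⊆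
      ((G.neighborFinset v).filter fun x => tentative L ω x ≠ none).image (tentative L ω) := by
    intro o ho
    simp only [Finset.mem_image, Finset.mem_filter] at ho
    obtain ⟨c, ⟨-, x, hx⟩, rfl⟩ := ho
    simp only [winners, Finset.mem_filter] at hx
    have hxc := (permanent_eq_some_iff.1 hx.2).1
    exact Finset.mem_image.2 ⟨x, Finset.mem_filter.2 ⟨hx.1, by simp [hxc]⟩, hxc⟩
  have h1 := Finset.card_le_card hsub
  rw [Finset.card_image_of_injective _ (Option.some_injective C)] at h1
  exact h1.trans Finset.card_image_le

theorem activeDegree_eq_sum (L : Palettes G C) (ω : ∀ v, Choice L v) (v : V) :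
    (activeDegree L ω v : ℝ) =
      ∑ x ∈ G.neighborFinset v, if tentative L ω x ≠ none then (1 : ℝ) else 0 := by
  rw [activeDegree, Finset.card_filter]; push_cast; rfl

theorem integral_activeDegree_le (L : Palettes G C) (v : V) :
    ∫ ω, (activeDegree L ω v : ℝ) ∂tentativeLaw L ≤ G.maxDegree / 100 := by
  have h : ∀ ω, (activeDegree L ω v : ℝ) =
      ∑ x ∈ G.neighborFinset v, ∑ c ∈ L.pal x, hit L c x ω := fun ω => by
    rw [activeDegree_eq_sum]
    refine Finset.sum_congr rfl fun x _ => ?_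
    cases hx : tentative L ω x with
    | none => simp [hit, hx]
    | some c => simp [hit, hx, tentative_mem hx]
  simp_rw [h]
  rw [integral_finsetSum _ fun _ _ => Integrable.of_finite]
  have hx : ∀ x ∈ G.neighborFinset v,
      ∫ ω, ∑ c ∈ L.pal x, hit L c x ω ∂tentativeLaw L ≤ 1 / 100 := fun x _ => by
    rw [integral_finsetSum _ fun _ _ => Integrable.of_finite, ← hitProb_mul G]
    refine (Finset.sum_le_card_nsmul _ _ _ fun c _ => integral_hit_le L c x).trans (le_of_eq ?_)
    rw [nsmul_eq_mul, L.card_pal]; push_cast; ring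
  refine (Finset.sum_le_card_nsmul _ _ _ hx).trans ?_
  rw [nsmul_eq_mul, G.card_neighborFinset_eq_degree]
  have : (G.degree v : ℝ) ≤ G.maxDegree := by exact_mod_cast G.degree_le_maxDegree v
  linarith

theorem integral_exp_activeDegree_le (L : Palettes G C) (v : V) :
    ∫ ω, Real.exp (1 * activeDegree L ω v) ∂tentativeLaw L ≤
      Real.exp ((G.maxDegree : ℝ) / 4) := by
  have h := ProductConcentration.integral_exp_le (fun v => (choiceLaw L v).toMeasure)
    (fun ω => (activeDegree L ω v : ℝ)) (fun x => if x ∈ G.neighborFinset v then 1 else 0) 1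
    fun x ω η => ?_
  · refine h.trans (Real.exp_le_exp.2 ?_)
    have h1 : ∫ ω, (activeDegree L ω v : ℝ) ∂(Measure.pi fun v => (choiceLaw L v).toMeasure) ≤
      G.maxDegree / 100 := integral_activeDegree_le L v
    have h2 : ∑ x, (if x ∈ G.neighborFinset v then (1 : ℝ) else 0) ^ 2 ≤ G.maxDegree := by
      simp only [ite_pow, one_pow, ne_eq, OfNat.ofNat_ne_zero, not_false_eq_true, zero_pow]
      rw [Finset.sum_boole, Finset.filter_univ_mem, G.card_neighborFinset_eq_degree]
      exact_mod_cast G.degree_le_maxDegree v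
    have hD : (0 : ℝ) ≤ G.maxDegree := Nat.cast_nonneg _
    linarith
  · rw [activeDegree_eq_sum, activeDegree_eq_sum, ← Finset.sum_sub_distrib]
    refine (Finset.abs_sum_le_sum_abs _ _).trans ?_
    rw [← Finset.sum_ite_eq' (G.neighborFinset v) x (fun _ => (1 : ℝ))]
    refine Finset.sum_le_sum fun y _ => ?_
    by_cases hy : y = x
    · rw [if_pos hy]; split_ifs <;> norm_num
    · have : tentative L (({x} : Finset V).piecewise η ω) y = tentative L ω y := by
        simp [tentative, Finset.piecewise, hy]
      simp [this, hy]

theorem measureReal_paletteSize_lt_le (L : Palettes G C) (v : V) :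
    (tentativeLaw L).real {ω | (paletteSize L ω v : ℝ) < (G.maxDegree : ℝ) / 2} ≤
      Real.exp (-((G.maxDegree : ℝ) / 4)) := by
  have hsub : {ω | (paletteSize L ω v : ℝ) < (G.maxDegree : ℝ) / 2} ⊆
      {ω | (G.maxDegree : ℝ) / 2 ≤ activeDegree L ω v} := by
    intro ω hω
    simp only [Set.mem_ofPred_eq] at hω ⊢
    have : (G.maxDegree : ℝ) + 1 ≤ paletteSize L ω v + activeDegree L ω v := by
      exact_mod_cast le_paletteSize_add_activeDegree L ω v
    linarith
  refine (measureReal_mono hsub).trans ((ProbabilityTheory.measure_ge_le_exp_mul_mgf _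
    (zero_le_one : (0 : ℝ) ≤ 1) Integrable.of_finite).trans ?_)
  rw [ProbabilityTheory.mgf]
  refine (mul_le_mul_of_nonneg_left (integral_exp_activeDegree_le L v)
    (Real.exp_nonneg _)).trans (le_of_eq ?_)
  rw [← Real.exp_add]
  congr 1
  ring

/-! ### The surplus of sparse vertices -/

/-- A sparse vertex of almost maximal degree has many nonadjacent pairs of neighbors. -/
theorem le_card_nonadjacentPairs {ε : ℝ} {v : V} (hε : 0 ≤ ε) (hε1 : ε ≤ 1)
    (hv : IsSparse G ε v) (hdeg : (1 - 1 / 4 * ε ^ 2) * (G.maxDegree : ℝ) ≤ G.degree v)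
    (hlarge : 4 ≤ ε * G.maxDegree) :
    (ε * G.maxDegree / 2) ^ 2 ≤ ((nonadjacentPairs G v).card : ℝ) := by
  set N := G.neighborFinset v with hN
  set D : ℝ := (G.maxDegree : ℝ) with hD
  have hD0 : 0 ≤ D := Nat.cast_nonneg _
  have hNcard : (N.card : ℝ) = G.degree v := by rw [hN, G.card_neighborFinset_eq_degree]
  have hεε : ε ^ 2 * D ≤ ε * D := mul_le_mul_of_nonneg_right (by nlinarith) hD0
  have hv' : ((friends G ε v).card : ℝ) < (1 - ε) * D := not_le.1 hv
  set A := N \ friends G ε v with hA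
  -- The degree bound leaves `εD - ε²D/4 ≥ 3εD/4`. In `hrow` the vertex `u` itself costs 1 more,
  -- absorbed by `εD/4 ≥ 1`.
  have hAcard : ε * D / 2 ≤ (A.card : ℝ) := by
    have h1 : N.card ≤ A.card + (friends G ε v).card := by
      have := Finset.le_card_sdiff (friends G ε v) N
      rw [← hA] at this
      omega
    have h2 : (N.card : ℝ) ≤ A.card + (friends G ε v).card := by exact_mod_cast h1
    linarith
  have hrow : ∀ u ∈ A, ε * D / 2 ≤ ((N.filter fun y => u ≠ y ∧ ¬ G.Adj u y).card : ℝ) := by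
    intro u hu
    rw [hA, Finset.mem_sdiff] at hu
    have hadj : G.Adj v u := (G.mem_neighborFinset v u).1 hu.1
    have hcommon : ((N ∩ G.neighborFinset u).card : ℝ) < (1 - ε) * D := by
      by_contra hcon
      refine hu.2 ?_
      simp only [friends, Finset.mem_filter, Finset.mem_univ, true_and]
      exact ⟨hadj, not_lt.1 hcon⟩
    have hcover : N ⊆ (N.filter fun y => u ≠ y ∧ ¬ G.Adj u y) ∪
        ((N ∩ G.neighborFinset u) ∪ {u}) := by
      intro y hy
      simp only [Finset.mem_union, Finset.mem_filter, Finset.mem_inter, hy, true_and,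
        G.mem_neighborFinset, Finset.mem_singleton]
      tauto
    have h1 := (Finset.card_le_card hcover).trans ((Finset.card_union_le _ _).trans
      (Nat.add_le_add_left (Finset.card_union_le _ _) _))
    rw [Finset.card_singleton] at h1
    have h2 : (N.card : ℝ) ≤ ((N.filter fun y => u ≠ y ∧ ¬ G.Adj u y).card : ℝ) +
      (((N ∩ G.neighborFinset u).card : ℝ) + 1) := by exact_mod_cast h1
    linarith
  have hsum : ((nonadjacentPairs G v).card : ℝ) =
      ∑ u ∈ N, ((N.filter fun y => u ≠ y ∧ ¬ G.Adj u y).card : ℝ) := by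
    rw [nonadjacentPairs, Finset.card_filter, Finset.sum_product]
    simp only [Finset.card_filter]
    push_cast
    rfl
  rw [hsum]
  calc (ε * D / 2) ^ 2 = (ε * D / 2) * (ε * D / 2) := sq _
    _ ≤ A.card * (ε * D / 2) := mul_le_mul_of_nonneg_right hAcard (by positivity)
    _ = A.card • (ε * D / 2) := (nsmul_eq_mul _ _).symm
    _ ≤ ∑ u ∈ A, ((N.filter fun y => u ≠ y ∧ ¬ G.Adj u y).card : ℝ) :=
        Finset.card_nsmul_le_sum _ _ _ hrow
    _ ≤ _ := Finset.sum_le_sum_of_subset_of_nonneg Finset.sdiff_subset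
        fun _ _ _ => Nat.cast_nonneg _

theorem measureReal_excess_le_le (L : Palettes G C) (v : V) {s : ℝ} (hs : 0 ≤ s)
    (hD : 0 < G.maxDegree) (hE : 2 * s ≤ ∫ ω, (excess L ω v : ℝ) ∂tentativeLaw L) :
    (tentativeLaw L).real {ω | (excess L ω v : ℝ) ≤ s} ≤
      Real.exp (-(s ^ 2 / (4 * G.maxDegree))) := by
  have hD' : (0 : ℝ) < G.maxDegree := by exact_mod_cast hD
  -- This choice minimizes the Chernoff exponent `l²D - ls`.
  set l : ℝ := s / (2 * G.maxDegree) with hl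
  have hl0 : 0 ≤ l := by positivity
  refine (ProbabilityTheory.measure_le_le_exp_mul_mgf s (neg_nonpos.2 hl0)
    Integrable.of_finite).trans ?_
  rw [ProbabilityTheory.mgf]
  refine (mul_le_mul_of_nonneg_left (integral_exp_excess_le L v (-l))
    (Real.exp_nonneg _)).trans ?_
  rw [← Real.exp_add]
  refine Real.exp_le_exp.2 ?_
  have h1 := mul_le_mul_of_nonneg_left hE hl0
  have h2 : l ^ 2 * G.maxDegree - l * s = -(s ^ 2 / (4 * G.maxDegree)) := by
    rw [hl]; field_simp; ring
  nlinarith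

theorem measureReal_surplus_lt_le (L : Palettes G C) {ε : ℝ} {v : V} (hε : 0 ≤ ε) (hε1 : ε ≤ 1)
    (hv : IsSparse G ε v) (hlarge : 4 ≤ ε * G.maxDegree) :
    (tentativeLaw L).real {ω | (surplus L ω v : ℝ) < 1 / 10 ^ 6 * ε ^ 2 * G.maxDegree} ≤
      Real.exp (-(ε ^ 4 * G.maxDegree / (4 * 10 ^ 12))) := by
  set D : ℝ := (G.maxDegree : ℝ) with hD
  have hDpos : 0 < G.maxDegree := by
    rcases Nat.eq_zero_or_pos G.maxDegree with h | h
    · rw [hD, h] at hlarge; norm_num at hlarge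
    · exact h
  have hD1 : 1 ≤ D := by rw [hD]; exact_mod_cast hDpos
  have hD0 : 0 < D := by linarith
  have hsur : ∀ ω, D + 1 - G.degree v + excess L ω v ≤ (surplus L ω v : ℝ) := fun ω => by
    rw [hD]; exact_mod_cast le_surplus L ω v
  have hdegD : (G.degree v : ℝ) ≤ D := by rw [hD]; exact_mod_cast G.degree_le_maxDegree v
  have hε2D : 0 ≤ ε ^ 2 * D := by positivity
  by_cases hdeg : (1 - 1 / 4 * ε ^ 2) * D ≤ G.degree v
  · have hP := le_card_nonadjacentPairs hε hε1 hv hdeg hlarge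
    rw [← hD] at hP
    have hq : 1 / (200 * D) ≤ hitProb G := by
      unfold hitProb
      exact one_div_le_one_div_of_le (by positivity) (by linarith)
    -- The mean is at least `(97/20000) · ε²D/800`, about `6 · 10⁻⁶ ε²D`, so the target `10⁻⁶ ε²D`
    -- is below half of it.
    have hE : 2 * (1 / 10 ^ 6 * ε ^ 2 * D) ≤ ∫ ω, (excess L ω v : ℝ) ∂tentativeLaw L := by
      refine le_trans ?_ (card_nonadjacentPairs_le_integral_excess L v)
      have h1 : 1 / (200 * D) * (ε * D / 2) ^ 2 ≤ hitProb G * (nonadjacentPairs G v).card :=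
        mul_le_mul hq hP (by positivity) (hitProb_pos G).le
      have h2 : 1 / (200 * D) * (ε * D / 2) ^ 2 = ε ^ 2 * D / 800 := by field_simp; ring
      linarith
    have hsub : {ω | (surplus L ω v : ℝ) < 1 / 10 ^ 6 * ε ^ 2 * D} ⊆
        {ω | (excess L ω v : ℝ) ≤ 1 / 10 ^ 6 * ε ^ 2 * D} := by
      intro ω hω
      simp only [Set.mem_ofPred_eq] at hω ⊢
      linarith [hsur ω]
    refine (measureReal_mono hsub).trans
      ((measureReal_excess_le_le L v (by positivity) hDpos hE).trans (le_of_eq ?_))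
    congr 2
    rw [← hD]
    field_simp
  · have hempty : {ω | (surplus L ω v : ℝ) < 1 / 10 ^ 6 * ε ^ 2 * D} = ∅ := by
      refine Set.eq_empty_of_forall_notMem fun ω hω => ?_
      simp only [Set.mem_ofPred_eq] at hω
      have h0 : (0 : ℝ) ≤ excess L ω v := Nat.cast_nonneg _
      linarith [hsur ω, not_le.1 hdeg]
    rw [hempty, measureReal_empty]
    exact Real.exp_nonneg _

end InitialColoring

end

/-! ### The union bound over all vertices -/

theorem mainTheorem4 :
    ∃ c : ℝ, 0 < c ∧ ∀ K' : ℝ, 0 < K' → ∃ K₀ : ℝ, 0 < K₀ ∧ ∀ K : ℝ, K₀ ≤ K →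
      ∀ (V : Type*) [Fintype V] [DecidableEq V] (G : SimpleGraph V) [DecidableRel G.Adj]
        (C : Type*) [DecidableEq C] (L : InitialColoring.Palettes G C)
        (ε : ℝ), 0 ≤ ε → ε ≤ 1 →
        K * Real.log (Fintype.card V : ℝ) ≤ ε ^ 4 * (G.maxDegree : ℝ) →
        1 - (Fintype.card V : ℝ) ^ (-K') ≤
          (InitialColoring.tentativeLaw L).real
            {ω | (∀ v, (G.maxDegree : ℝ) / 2 ≤ (InitialColoring.paletteSize L ω v : ℝ)) ∧
              ∀ v, InitialColoring.IsSparse G ε v →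
                c * ε ^ 2 * (G.maxDegree : ℝ) ≤ (InitialColoring.surplus L ω v : ℝ)} := by
  -- The factor `4 * 10 ^ 12` cancels the denominator in `measureReal_surplus_lt_le`. The summand 2
  -- gives each of the `2n` bad events probability at most `n ^ (-K') / n ^ 2`, for a total of at
  -- most `n ^ (-K')` when `n ≥ 2`.
  refine ⟨1 / 10 ^ 6, by norm_num, fun K' hK' => ⟨4 * 10 ^ 12 * (K' + 2), by positivity,
    fun K hK V _ _ G _ C _ L ε hε hε1 hlog => ?_⟩⟩
  rcases Nat.eq_zero_or_pos (Fintype.card V) with h0 | hpos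
  · have : IsEmpty V := Fintype.card_eq_zero_iff.1 h0
    simp [Real.rpow_nonneg]
  -- For `n = 1` the logarithm vanishes and the hypothesis gives no bound on `D`, but the claimed
  -- probability is `0`.
  rcases Nat.eq_or_lt_of_le (Nat.succ_le_of_lt hpos) with h1 | h2
  · rw [← h1]
    simp
  set n : ℝ := (Fintype.card V : ℝ) with hn
  set D : ℝ := (G.maxDegree : ℝ) with hD
  have hn2 : 2 ≤ n := by rw [hn]; exact_mod_cast h2
  have hn0 : 0 < n := by linarith
  have hD0 : 0 ≤ D := Nat.cast_nonneg _
  have hlog2 : 1 / 2 ≤ Real.log n := by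
    have := Real.log_le_log (by norm_num) hn2
    linarith [Real.log_two_gt_d9]
  have hKlog : 4 * 10 ^ 12 * ((K' + 2) * Real.log n) ≤ ε ^ 4 * D := by
    have := mul_le_mul_of_nonneg_right hK (by linarith : 0 ≤ Real.log n)
    linarith
  have hε4 : ε ^ 4 ≤ ε := pow_le_of_le_one hε hε1 (by norm_num)
  have hlarge : 4 ≤ ε * D := by
    have h3 : ε ^ 4 * D ≤ ε * D := mul_le_mul_of_nonneg_right hε4 hD0
    have h4 : 1 ≤ (K' + 2) * Real.log n := by nlinarith
    linarith
  have hε4D : ε ^ 4 * D ≤ D := mul_le_of_le_one_left hD0 (hε4.trans hε1)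
  have hpow : Real.exp (-((K' + 2) * Real.log n)) = n ^ (-K') / n ^ 2 := by
    rw [← Real.rpow_natCast n 2, ← Real.rpow_sub hn0, Real.rpow_def_of_pos hn0]
    congr 1
    push_cast
    ring
  set μ := InitialColoring.tentativeLaw L
  set B₁ : V → Set (∀ v, InitialColoring.Choice L v) := fun v =>
    {ω | (InitialColoring.paletteSize L ω v : ℝ) < D / 2} with hB₁
  set B₂ : V → Set (∀ v, InitialColoring.Choice L v) := fun v =>
    {ω | InitialColoring.IsSparse G ε v ∧
      (InitialColoring.surplus L ω v : ℝ) < 1 / 10 ^ 6 * ε ^ 2 * D} with hB₂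
  have hP₁ : ∀ v, μ.real (B₁ v) ≤ n ^ (-K') / n ^ 2 := fun v => by
    rw [← hpow]
    refine (InitialColoring.measureReal_paletteSize_lt_le L v).trans (Real.exp_le_exp.2 ?_)
    have : 0 ≤ (K' + 2) * Real.log n := by nlinarith
    linarith
  have hP₂ : ∀ v, μ.real (B₂ v) ≤ n ^ (-K') / n ^ 2 := fun v => by
    by_cases hv : InitialColoring.IsSparse G ε v
    · rw [← hpow]
      simp only [hB₂, hv, true_and]
      refine (InitialColoring.measureReal_surplus_lt_le L hε hε1 hv hlarge).trans
        (Real.exp_le_exp.2 ?_)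
      rw [neg_le_neg_iff, le_div_iff₀ (by norm_num)]
      linarith
    · simp only [hB₂, hv, false_and, Set.ofPred_false, measureReal_empty]
      positivity
  set S : Set (∀ v, InitialColoring.Choice L v) :=
    {ω | (∀ v, D / 2 ≤ (InitialColoring.paletteSize L ω v : ℝ)) ∧
      ∀ v, InitialColoring.IsSparse G ε v →
        1 / 10 ^ 6 * ε ^ 2 * D ≤ (InitialColoring.surplus L ω v : ℝ)} with hS
  have hcompl : Sᶜ ⊆ ⋃ v, (B₁ v ∪ B₂ v) := by
    intro ω hω
    by_contra hcon
    simp only [Set.mem_iUnion, Set.mem_union, not_exists, not_or, hB₁, hB₂, Set.mem_ofPred_eq,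
      not_and, not_lt] at hcon
    exact hω ⟨fun v => (hcon v).1, fun v hv => (hcon v).2 hv⟩
  have hbad : μ.real Sᶜ ≤ n ^ (-K') := by
    refine (measureReal_mono hcompl).trans ((measureReal_iUnion_fintype_le _).trans ?_)
    have : ∀ v ∈ Finset.univ, μ.real (B₁ v ∪ B₂ v) ≤ 2 * (n ^ (-K') / n ^ 2) := fun v _ =>
      (measureReal_union_le _ _).trans (by linarith [hP₁ v, hP₂ v])
    refine (Finset.sum_le_card_nsmul _ _ _ this).trans ?_
    rw [nsmul_eq_mul, Finset.card_univ, ← hn]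
    have hpos : 0 < n ^ (-K') := Real.rpow_pos_of_pos hn0 _
    have e : n * (2 * (n ^ (-K') / n ^ 2)) = n ^ (-K') * (2 / n) := by field_simp
    rw [e]
    exact mul_le_of_le_one_right hpos.le ((div_le_one hn0).2 hn2)
  have hmeas : MeasurableSet S := (Set.toFinite S).measurableSet
  have := probReal_compl_eq_one_sub (μ := μ) hmeas
  linarith
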